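/- **Logic.** Let $\mathsf{PVAR}$ be a countably infinite set of program variables and $\mathsf{LOC}$ a countably infinite set of locations. Formulae of quantifier-free separation logic are given by $$\varphi ::= x = y \mid x \hookrightarrow y \mid \mathsf{emp} \mid \neg\varphi \mid \varphi\wedge\varphi \mid \varphi * \varphi \mid \varphi \mathbin{-\!*} \varphi \qquad (x,y\in\mathsf{PVAR}).$$ They are interpreted on memory states $(s,h)$, with $s:\mathsf{PVAR}\to\mathsf{LOC}$ and $h:\mathsf{LOC}\rightharpoonup\mathsf{LOC}$ a partial function with finite domain: $x=y$ holds iff $s(x)=s(y)$; $x\hookrightarrow y$ iff $s(x) \in \mathrm{dom}(h)$ and $h(s(x))=s(y)$; $\mathsf{emp}$ iff $\mathrm{dom}(h)=\emptyset$; $\varphi*\psi$ iff $h=h_1+h_2$ for some disjoint heaps with $(s,h_1)\models\varphi$ and $(s,h_2)\models\psi$; $\varphi\mathbin{-\!*}\psi$ iff $(s,h+h_1)\models\psi$ for every $h_1$ disjoint from $h$ with $(s,h_1)\models\varphi$. A formula is satisfiable if some memory state satisfies it. Abbreviations: the usual $\Rightarrow,\Leftrightarrow$; $\bot := x\neq x$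 (for a fixed variable $x$), $\top := \neg\bot$; septraction $\varphi\mathbin{-\!\circledast}\psi := \neg(\varphi\mathbin{-\!*}\neg\psi)$; $\mathsf{alloc}(x) := (x\hookrightarrow x)\mathbin{-\!*}\bot$; $\mathsf{size}\ge 0 := \top$, $\mathsf{size}\ge 1 := \neg\mathsf{emp}$, $\mathsf{size}\ge\beta+1 := \neg\mathsf{emp} * \mathsf{size}\ge\beta$ for $\beta\ge1$; $\mathsf{size}=\beta := \mathsf{size}\ge\beta\wedge\neg\,\mathsf{size}\ge\beta+1$. Write $a\mathbin{\dot-}b=\max(0,a-b)$; the empty conjunction is $\top$. **Proof system $\mathcal H_C(*,\mathbin{-\!*})$.** A complete set of axiom schemata for the propositional calculus with modus ponens, together with the axioms * $x=x$; $\ \varphi\wedge x=y\Rightarrow\varphi[y\leftarrow x]$ (every occurrence of $y$ replaced by $x$); $\ x\hookrightarrow y\Rightarrow\mathsf{alloc}(x)$; $\ x\hookrightarrow y\wedge x\hookrightarrow z\Rightarrow y=z$; * $\varphi*\psi\Leftrightarrow\psi*\varphi$; $\ (\varphi*\psi)*\chi\Leftrightarrow\varphi*(\psi*\chi)$; $\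 \varphi\Leftrightarrow\varphi*\mathsf{emp}$; $\ \mathsf{alloc}(x)*\mathsf{alloc}(x)\Leftrightarrow\bot$; $\ e*\top\Rightarrow e$ for $e\in\{\neg\mathsf{emp},\,x=y,\,x\ne y,\,x\hookrightarrow y\}$; $\ \neg\mathsf{alloc}(x)*\neg\mathsf{alloc}(x)\Rightarrow\neg\mathsf{alloc}(x)$; $\ (\mathsf{alloc}(x)\wedge\neg x\hookrightarrow y)*\top\Rightarrow\neg x\hookrightarrow y$; $\ \mathsf{alloc}(x)\Rightarrow(\mathsf{alloc}(x)\wedge\mathsf{size}=1)*\top$; $\ \neg\mathsf{emp}\Rightarrow\mathsf{size}=1*\top$; $\ \neg\mathsf{size}\ge\beta_1*\neg\mathsf{size}\ge\beta_2\Rightarrow\neg\mathsf{size}\ge\beta_1+\beta_2\mathbin{\dot-}1$; $\ \mathsf{alloc}(x)\wedge\mathsf{alloc}(y)\wedge x\neq y\Rightarrow\mathsf{size}\ge2$; * for finite $Y\subseteq\mathsf{PVAR}$: $\ (\mathsf{size}=1\wedge\bigwedge_{x\in Y}\neg\mathsf{alloc}(x))\mathbin{-\!\circledast}\top$; $\ \neg\mathsf{alloc}(x)\Rightarrow\big((x\hookrightarrow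 y\wedge\mathsf{size}=1)\mathbin{-\!\circledast}\top\big)$; $\ \neg\mathsf{alloc}(x)\Rightarrow\big((\mathsf{alloc}(x)\wedge\mathsf{size}=1\wedge\bigwedge_{y\in Y}\neg x\hookrightarrow y)\mathbin{-\!\circledast}\top\big)$; and the rules: from $\varphi\Rightarrow\chi$ infer $\varphi*\psi\Rightarrow\chi*\psi$; from $\varphi*\psi\Rightarrow\chi$ infer $\varphi\Rightarrow(\psi\mathbin{-\!*}\chi)$; from $\varphi\Rightarrow(\psi\mathbin{-\!*}\chi)$ infer $\varphi*\psi\Rightarrow\chi$. Write $\vdash\varphi$ if $\varphi$ is derivable in this system. **Core types.** For finite $X\subseteq\mathsf{PVAR}$ and $\alpha\in\mathbb N$ let $\mathsf{Core}(X,\alpha)=\{x=y,\ \mathsf{alloc}(x),\ x\hookrightarrow y,\ \mathsf{size}\ge\beta\mid x,y\in X,\ 0\le\beta\le\alpha\}$. A literal is a core formula or its negation; $\mathsf{Conj}(\mathsf{Core}(X,\alpha))$ is the set of conjunctions of literals built upon $\mathsf{Core}(X,\alpha)$, and $L\sqsubseteq\varphi$ means that every literal of $L$ occurs in the conjunction $\varphi$.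 $\mathsf{CoreTypes}(X,\alpha)$ is the set of $\varphi\in\mathsf{Conj}(\mathsf{Core}(X,\alpha))$ such that, for each $c\in\mathsf{Core}(X,\alpha)$, exactly one of $c,\neg c$ is a literal of $\varphi$. For core types $\varphi,\psi$, let $\langle\varphi\mathbin{-\!\circledast}\psi\rangle$ be the conjunction (in any order and bracketing) of the following literals: * $x\sim y$ if $x\sim y\sqsubseteq\varphi$ or $x\sim y\sqsubseteq\psi$, for $\sim\,\in\{=,\neq\}$; * $\mathsf{alloc}(x)$ if $\neg\mathsf{alloc}(x)\sqsubseteq\varphi$ and $\mathsf{alloc}(x)\sqsubseteq\psi$; * $\neg\mathsf{alloc}(x)$ if $\neg\mathsf{alloc}(x)\sqsubseteq\psi$ or $\mathsf{alloc}(x)\sqsubseteq\varphi$; * $\neg x\hookrightarrow y$ if $\neg x\hookrightarrow y\sqsubseteq\psi$; * $x\hookrightarrow y$ if $\neg\mathsf{alloc}(x)\sqsubseteq\varphi$ and $x\hookrightarrow y\sqsubseteq\psi$; * $x\neq x$ if $\mathsf{alloc}(x)\wedge\neg x\hookrightarrow y\sqsubseteq\varphi$ and $x\hookrightarrow y\sqsubseteq\psi$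 for some $y$; or $x\hookrightarrow y\sqsubseteq\varphi$ and $\neg x\hookrightarrow y\sqsubseteq\psi$ for some $y$; or $\mathsf{alloc}(x)\sqsubseteq\varphi$ and $\neg\mathsf{alloc}(x)\sqsubseteq\psi$; * $\mathsf{size}\ge(\beta_2+1)\mathbin{\dot-}\beta_1$ if $\neg\mathsf{size}\ge\beta_1\sqsubseteq\varphi$ and $\mathsf{size}\ge\beta_2\sqsubseteq\psi$; * $\neg\mathsf{size}\ge\beta_2\mathbin{\dot-}\beta_1$ if $\mathsf{size}\ge\beta_1\sqsubseteq\varphi$ and $\neg\mathsf{size}\ge\beta_2\sqsubseteq\psi$. **Lemma.** Let $X\subseteq\mathsf{PVAR}$ be finite, let $\alpha\ge|X|$, and let $\varphi,\psi\in\mathsf{CoreTypes}(X,\alpha)$. Then there is a conjunction $\chi\in\mathsf{Conj}(\mathsf{Core}(X,\alpha))$ such that $$\vdash(\varphi\mathbin{-\!\circledast}\psi)\Leftrightarrow\chi .$$ Moreover, if $\varphi$ and $\psi$ are satisfiable, then $\langle\varphi\mathbin{-\!\circledast}\psi\rangle$ belongs to $\mathsf{Conj}(\mathsf{Core}(X,\alpha))$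 and $\vdash(\varphi\mathbin{-\!\circledast}\psi)\Leftrightarrow\langle\varphi\mathbin{-\!\circledast}\psi\rangle$. -/

import Mathlib

namespace QFSL

/-- Program variables (a countably infinite set). -/
abbrev Var := ℕ

/-- Locations (a countably infinite set). -/
abbrev Loc := ℕ

/-- Formulae of quantifier-free separation logic. -/
inductive Formula where
  | eq (x y : Var)
  | pts (x y : Var)
  | emp
  | neg (φ : Formula)
  | conj (φ ψ : Formula)
  | star (φ ψ : Formula)
  | wand (φ ψ : Formula)

/-- Heaps: partial functions from locations to locations with finite domain. -/
structure Heap where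
  map : Loc → Option Loc
  finite_dom : {l : Loc | map l ≠ none}.Finite

namespace Heap

/-- The domain of a heap. -/
def dom (h : Heap) : Set Loc := {l | h.map l ≠ none}

/-- Disjointness of heaps. -/
def Disj (h₁ h₂ : Heap) : Prop := Disjoint h₁.dom h₂.dom

/-- The union of two heaps; only used for disjoint heaps. -/
def add (h₁ h₂ : Heap) : Heap where
  map l := (h₁.map l).orElse fun _ => h₂.map l
  finite_dom := by
    refine (h₁.finite_dom.union h₂.finite_dom).subset ?_
    intro l hl
    by_cases h : h₁.map l = none
    · right
      simpa [h] using hl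
    · exact Or.inl h

end Heap

/-- Stores: total valuations of the program variables. -/
abbrev Store := Var → Loc

/-- The satisfaction relation of memory states. -/
def Sat (s : Store) : Heap → Formula → Prop
  | _, .eq x y => s x = s y
  | h, .pts x y => h.map (s x) = some (s y)
  | h, .emp => h.dom = ∅
  | h, .neg φ => ¬ Sat s h φ
  | h, .conj φ ψ => Sat s h φ ∧ Sat s h ψ
  | h, .star φ ψ => ∃ h₁ h₂ : Heap, h₁.Disj h₂ ∧ h₁.add h₂ = h ∧ Sat s h₁ φ ∧ Sat s h₂ ψ
  | h, .wand φ ψ => ∀ h₁ : Heap, h₁.Disj h → Sat s h₁ φ → Sat s (h.add h₁) ψ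

/-- A formula is satisfiable if it holds in some memory state. -/
def Satisfiable (φ : Formula) : Prop := ∃ (s : Store) (h : Heap), Sat s h φ

namespace Formula

/-- Disequality `x ≠ y`. -/
def ne (x y : Var) : Formula := neg (eq x y)

/-- The contradiction `x ≠ x`, for a fixed variable `x`. -/
def bot : Formula := ne 0 0

def top : Formula := neg bot

def imp (φ ψ : Formula) : Formula := neg (conj φ (neg ψ))

def iff (φ ψ : Formula) : Formula := conj (imp φ ψ) (imp ψ φ)

/-- Septraction. -/
def sept (φ ψ : Formula) : Formula := neg (wand φ (neg ψ))

/-- `alloc(x)`. -/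
def alloc (x : Var) : Formula := wand (pts x x) bot

/-- `size ≥ β`. -/
def sizeGe : ℕ → Formula
  | 0 => top
  | 1 => neg emp
  | (β + 2) => star (neg emp) (sizeGe (β + 1))

/-- `size = β`. -/
def sizeEq (β : ℕ) : Formula := conj (sizeGe β) (neg (sizeGe (β + 1)))

/-- Conjunction of a list of formulae, the empty conjunction being `⊤`. -/
def bigConj : List Formula → Formula
  | [] => top
  | [φ] => φ
  | φ :: ψ :: l => conj φ (bigConj (ψ :: l))

/-- Replace every occurrence of the variable `y` with the variable `x`. -/
def subst (y x : Var) : Formula → Formula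
  | eq u v => eq (if u = y then x else u) (if v = y then x else v)
  | pts u v => pts (if u = y then x else u) (if v = y then x else v)
  | emp => emp
  | neg φ => neg (subst y x φ)
  | conj φ ψ => conj (subst y x φ) (subst y x ψ)
  | star φ ψ => star (subst y x φ) (subst y x ψ)
  | wand φ ψ => wand (subst y x φ) (subst y x ψ)

end Formula

open Formula in
/-- Derivability in the Hilbert-style proof system for quantifier-free separation logic.
In `wandSize` and `wandAlloc` a finite set of variables is given by a list that enumerates it. -/
inductive Provable : Formula → Prop
  -- propositional calculus
  | implK (φ ψ : Formula) : Provable (imp φ (imp ψ φ))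
  | implS (φ ψ χ : Formula) :
      Provable (imp (imp φ (imp ψ χ)) (imp (imp φ ψ) (imp φ χ)))
  | contra (φ ψ : Formula) : Provable (imp (imp (neg φ) (neg ψ)) (imp ψ φ))
  | conjLeft (φ ψ : Formula) : Provable (imp (conj φ ψ) φ)
  | conjRight (φ ψ : Formula) : Provable (imp (conj φ ψ) ψ)
  | conjIntro (φ ψ : Formula) : Provable (imp φ (imp ψ (conj φ ψ)))
  | mp {φ ψ : Formula} : Provable (imp φ ψ) → Provable φ → Provable ψ
  -- core formulae
  | eqRef (x : Var) : Provable (eq x x)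
  | eqSub (φ : Formula) (x y : Var) : Provable (imp (conj φ (eq x y)) (subst y x φ))
  | pointAlloc (x y : Var) : Provable (imp (pts x y) (alloc x))
  | pointInj (x y z : Var) : Provable (imp (conj (pts x y) (pts x z)) (eq y z))
  -- separating conjunction
  | starComm (φ ψ : Formula) : Provable (iff (star φ ψ) (star ψ φ))
  | starAssoc (φ ψ χ : Formula) :
      Provable (iff (star (star φ ψ) χ) (star φ (star ψ χ)))
  | starEmp (φ : Formula) : Provable (iff φ (star φ emp))
  | doubleAlloc (x : Var) : Provable (iff (star (alloc x) (alloc x)) bot)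
  | monoNotEmp : Provable (imp (star (neg emp) top) (neg emp))
  | monoEq (x y : Var) : Provable (imp (star (eq x y) top) (eq x y))
  | monoNe (x y : Var) : Provable (imp (star (ne x y) top) (ne x y))
  | monoPts (x y : Var) : Provable (imp (star (pts x y) top) (pts x y))
  | allocNeg (x : Var) :
      Provable (imp (star (neg (alloc x)) (neg (alloc x))) (neg (alloc x)))
  | pointsNeg (x y : Var) :
      Provable (imp (star (conj (alloc x) (neg (pts x y))) top) (neg (pts x y)))
  | allocSizeOne (x : Var) :
      Provable (imp (alloc x) (star (conj (alloc x) (sizeEq 1)) top))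
  | sizeOne : Provable (imp (neg emp) (star (sizeEq 1) top))
  | sizeNeg (β₁ β₂ : ℕ) :
      Provable (imp (star (neg (sizeGe β₁)) (neg (sizeGe β₂))) (neg (sizeGe (β₁ + β₂ - 1))))
  | sizeTwo (x y : Var) :
      Provable (imp (conj (conj (alloc x) (alloc y)) (ne x y)) (sizeGe 2))
  -- separating implication
  | wandSize (X : List Var) :
      Provable (sept (conj (sizeEq 1) (bigConj (X.map fun x => neg (alloc x)))) top)
  | wandPointsTo (x y : Var) :
      Provable (imp (neg (alloc x)) (sept (conj (pts x y) (sizeEq 1)) top))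
  | wandAlloc (x : Var) (X : List Var) :
      Provable (imp (neg (alloc x))
        (sept (conj (conj (alloc x) (sizeEq 1)) (bigConj (X.map fun y => neg (pts x y)))) top))
  -- inference rules
  | starIntro {φ χ : Formula} (ψ : Formula) :
      Provable (imp φ χ) → Provable (imp (star φ ψ) (star χ ψ))
  | starAdj {φ ψ χ : Formula} :
      Provable (imp (star φ ψ) χ) → Provable (imp φ (wand ψ χ))
  | wandAdj {φ ψ χ : Formula} :
      Provable (imp φ (wand ψ χ)) → Provable (imp (star φ ψ) χ)

/-- Core formulae. -/
inductive Core where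
  | eq (x y : Var)
  | alloc (x : Var)
  | pts (x y : Var)
  | size (β : ℕ)

/-- The formula that a core formula abbreviates. -/
def Core.toFormula : Core → Formula
  | .eq x y => .eq x y
  | .alloc x => .alloc x
  | .pts x y => .pts x y
  | .size β => .sizeGe β

/-- The set `Core(X, α)` of core formulae over the variables `X` and with bound `α`. -/
def coreFormulae (X : Finset Var) (α : ℕ) : Set Core :=
  {c | match c with
    | .eq x y => x ∈ X ∧ y ∈ X
    | .alloc x => x ∈ X
    | .pts x y => x ∈ X ∧ y ∈ X
    | .size β => β ≤ α}

/-- Literals: core formulae and their negations. -/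
inductive Literal where
  | pos (c : Core)
  | neg (c : Core)

/-- The core formula upon which a literal is built. -/
def Literal.core : Literal → Core
  | .pos c => c
  | .neg c => c

def Literal.toFormula : Literal → Formula
  | .pos c => c.toFormula
  | .neg c => .neg c.toFormula

/-- Conjunctions of literals, in any order and with any bracketing.
The empty conjunction is `⊤`, which is the core formula `size ≥ 0`. -/
inductive LitConj where
  | top
  | lit (l : Literal)
  | and (φ ψ : LitConj)

namespace LitConj

def toFormula : LitConj → Formula
  | top => .top
  | lit l => l.toFormula
  | and φ ψ => .conj φ.toFormula ψ.toFormula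

/-- The set of literals of a conjunction. -/
def lits : LitConj → Set Literal
  | top => ∅
  | lit l => {l}
  | and φ ψ => φ.lits ∪ ψ.lits

end LitConj

/-- `Conj(Core(X, α))`: conjunctions of literals built upon `Core(X, α)`. -/
def coreConj (X : Finset Var) (α : ℕ) : Set LitConj :=
  {φ | ∀ l ∈ φ.lits, l.core ∈ coreFormulae X α}

/-- `CoreTypes(X, α)`: for each core formula of `Core(X, α)`, exactly one of it and its negation
is a literal of the conjunction. -/
def coreTypes (X : Finset Var) (α : ℕ) : Set LitConj :=
  {φ | φ ∈ coreConj X α ∧ ∀ c ∈ coreFormulae X α,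
    (.pos c ∈ φ.lits ∨ .neg c ∈ φ.lits) ∧ ¬ (.pos c ∈ φ.lits ∧ .neg c ∈ φ.lits)}

/-- The literals of the explicit formula `⟨φ -⊛ ψ⟩` for the septraction of two core types. -/
inductive SeptLit (φ ψ : LitConj) : Literal → Prop
  | eq (x y : Var) : .pos (.eq x y) ∈ φ.lits ∨ .pos (.eq x y) ∈ ψ.lits →
      SeptLit φ ψ (.pos (.eq x y))
  | ne (x y : Var) : .neg (.eq x y) ∈ φ.lits ∨ .neg (.eq x y) ∈ ψ.lits →
      SeptLit φ ψ (.neg (.eq x y))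
  | alloc (x : Var) : .neg (.alloc x) ∈ φ.lits → .pos (.alloc x) ∈ ψ.lits →
      SeptLit φ ψ (.pos (.alloc x))
  | notAlloc_right (x : Var) : .neg (.alloc x) ∈ ψ.lits → SeptLit φ ψ (.neg (.alloc x))
  | notAlloc_left (x : Var) : .pos (.alloc x) ∈ φ.lits → SeptLit φ ψ (.neg (.alloc x))
  | notPts (x y : Var) : .neg (.pts x y) ∈ ψ.lits → SeptLit φ ψ (.neg (.pts x y))
  | pts (x y : Var) : .neg (.alloc x) ∈ φ.lits → .pos (.pts x y) ∈ ψ.lits →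
      SeptLit φ ψ (.pos (.pts x y))
  | absurd_pts (x y : Var) : .pos (.alloc x) ∈ φ.lits → .neg (.pts x y) ∈ φ.lits →
      .pos (.pts x y) ∈ ψ.lits → SeptLit φ ψ (.neg (.eq x x))
  | absurd_notPts (x y : Var) : .pos (.pts x y) ∈ φ.lits → .neg (.pts x y) ∈ ψ.lits →
      SeptLit φ ψ (.neg (.eq x x))
  | absurd_alloc (x : Var) : .pos (.alloc x) ∈ φ.lits → .neg (.alloc x) ∈ ψ.lits →
      SeptLit φ ψ (.neg (.eq x x))
  | size (β₁ β₂ : ℕ) : .neg (.size β₁) ∈ φ.lits → .pos (.size β₂) ∈ ψ.lits →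
      SeptLit φ ψ (.pos (.size (β₂ + 1 - β₁)))
  | notSize (β₁ β₂ : ℕ) : .pos (.size β₁) ∈ φ.lits → .neg (.size β₂) ∈ ψ.lits →
      SeptLit φ ψ (.neg (.size (β₂ - β₁)))

/-- `χ` is the formula `⟨φ -⊛ ψ⟩`, that is, the conjunction of the literals given by `SeptLit`
(in some order and with some bracketing). -/
def IsSeptFormula (φ ψ χ : LitConj) : Prop := ∀ l : Literal, l ∈ χ.lits ↔ SeptLit φ ψ l

end QFSL

namespace QFSL

/-! The proof replaces formal derivations by a canonical model. Worlds are the maximal consistent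
theories, and a formula is provable iff it belongs to every world. Call `c` a composition of `a` and
`b` when `star φ ψ ∈ c` for all `φ ∈ a`, `ψ ∈ b`. The structural axioms and adjunction rules make
this ternary relation behave like heap union: a separating conjunction, or a septraction, in a world
has witnessing worlds (`exists_rel_of_star`, `exists_rel_of_sept`), and composition has units and is
associative. The axioms on core formulae then say how equalities, allocation, points-to and sizes
pass between `a`, `b` and `c`.

It remains to compare septraction and explicit formula in each world `w`. If `sept φ ψ ∈ w`, then
some `c` containing `ψ` is a composition of `w` with some `a` containing `φ`, and each literal of
`SeptLit` follows from the transfer laws (`SeptLit.mem_of_rel`). Conversely, if `w` contains all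
these literals, a world `a` of core type `φ` that composes with `w` is assembled from one-cell
worlds supplied by the three septraction axioms (`exists_rel_coreFormulae`). The literals then force
`ψ` in the composition (`mem_of_forall_septLit`).

The construction of `a` needs only that the literals of `φ` hold in some `IsCoreModel`. Both worlds
and memory states are such models, so consistency and satisfiability of `φ` are treated alike,
without a soundness theorem. -/

open Formula

/-! ### Theories and maximal consistent worlds -/

/-- A theory: a set of formulae that contains the theorems and is closed under modus ponens. -/
structure IsTheory (T : Set Formula) : Prop where
  thm : ∀ {φ}, Provable φ → φ ∈ T
  mp : ∀ {φ ψ}, imp φ ψ ∈ T → φ ∈ T → ψ ∈ T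

namespace IsTheory

variable {T : Set Formula}

/-- The theory obtained by adding a hypothesis to `T`. -/
theorem adjoin (hT : IsTheory T) (χ : Formula) : IsTheory {ξ | imp χ ξ ∈ T} where
  thm h := hT.mp (hT.thm (.implK _ _)) (hT.thm h)
  mp h₁ h₂ := hT.mp (hT.mp (hT.thm (.implS _ _ _)) h₁) h₂

theorem subset_adjoin (hT : IsTheory T) (χ : Formula) : T ⊆ {ξ | imp χ ξ ∈ T} :=
  fun _ h => hT.mp (hT.thm (.implK _ _)) h

theorem mem_adjoin (hT : IsTheory T) (χ : Formula) : imp χ χ ∈ T :=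
  hT.mp (hT.mp (hT.thm (.implS χ (imp χ χ) χ)) (hT.thm (.implK _ _))) (hT.thm (.implK _ _))

theorem explosion (hT : IsTheory T) {χ : Formula} (h : neg χ ∈ T) (h' : χ ∈ T) (ξ : Formula) :
    ξ ∈ T :=
  hT.mp (hT.mp (hT.thm (.contra _ _)) (hT.mp (hT.thm (.implK _ (neg ξ))) h)) h'

/-- Reductio: contraposing `neg χ → neg (0 = 0)` against the theorem `0 = 0` yields `χ`. -/
theorem of_neg_imp_all (hT : IsTheory T) {χ : Formula} (h : ∀ ξ, imp (neg χ) ξ ∈ T) : χ ∈ T :=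
  hT.mp (hT.mp (hT.thm (.contra _ _)) (h (neg (eq 0 0)))) (hT.thm (.eqRef 0))

theorem of_neg_neg (hT : IsTheory T) {χ : Formula} (h : neg (neg χ) ∈ T) : χ ∈ T :=
  hT.of_neg_imp_all fun ξ => (hT.adjoin (neg χ)).explosion
    (hT.subset_adjoin _ h) (hT.mem_adjoin _) ξ

theorem neg_of_imp (hT : IsTheory T) {χ ψ : Formula} (h : imp χ ψ ∈ T) (h' : neg ψ ∈ T) :
    neg χ ∈ T :=
  hT.of_neg_imp_all fun ξ => by
    have hU := hT.adjoin (neg (neg χ))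
    exact hU.explosion (hT.subset_adjoin _ h')
      (hU.mp (hT.subset_adjoin _ h) (hU.of_neg_neg (hT.mem_adjoin _))) ξ

end IsTheory

theorem isTheory_provable : IsTheory {φ | Provable φ} := ⟨id, .mp⟩

/-- A world: a maximal consistent theory. -/
structure World where
  carrier : Set Formula
  isTheory : IsTheory carrier
  neg_iff : ∀ φ, neg φ ∈ carrier ↔ φ ∉ carrier

instance : Membership Formula World := ⟨fun w φ => φ ∈ w.carrier⟩

/-- Lindenbaum's lemma. -/
theorem IsTheory.exists_world {T : Set Formula} (hT : IsTheory T) {ψ : Formula} (hψ : ψ ∉ T) :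
    ∃ w : World, (∀ φ ∈ T, φ ∈ w) ∧ ψ ∉ w := by
  obtain ⟨M, hTM, hM⟩ := zorn_subset_nonempty {U : Set Formula | IsTheory U ∧ ψ ∉ U} (by
    intro c hc hchain hne
    obtain ⟨U₀, hU₀⟩ := hne
    refine ⟨⋃₀ c, ⟨⟨fun h => ⟨U₀, hU₀, (hc hU₀).1.thm h⟩, ?_⟩, ?_⟩,
      fun s hs => Set.subset_sUnion_of_mem hs⟩
    · rintro φ χ ⟨U, hU, h₁⟩ ⟨V, hV, h₂⟩
      rcases hchain.total hU hV with h | h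
      · exact ⟨V, hV, (hc hV).1.mp (h h₁) h₂⟩
      · exact ⟨U, hU, (hc hU).1.mp h₁ (h h₂)⟩
    · rintro ⟨U, hU, h⟩
      exact (hc hU).2 h) T ⟨hT, hψ⟩
  obtain ⟨hMT, hψM⟩ := hM.prop
  -- By maximality, adjoining any missing `χ` must bring in `ψ`.
  have key : ∀ χ, χ ∉ M → imp χ ψ ∈ M := by
    intro χ hχ
    by_contra h
    exact hχ (hM.le_of_ge ⟨hMT.adjoin χ, h⟩ (hMT.subset_adjoin χ) (hMT.mem_adjoin χ))
  have hneg : neg ψ ∈ M := by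
    by_contra h
    have hU := hMT.adjoin (neg ψ)
    exact hψM (hMT.of_neg_imp_all fun ξ => hU.explosion (hMT.mem_adjoin _) (key _ h) ξ)
  exact ⟨⟨M, hMT, fun φ => ⟨fun h h' => hψM (hMT.explosion h h' ψ),
    fun h => hMT.neg_of_imp (key φ h) hneg⟩⟩, fun _ h => hTM h, hψM⟩

namespace World

variable {w a b c d : World} {φ ψ χ : Formula}

theorem thm (w : World) (h : Provable φ) : φ ∈ w := w.isTheory.thm h

@[simp] theorem mem_neg : neg φ ∈ w ↔ φ ∉ w := w.neg_iff φ

@[simp] theorem mem_conj : conj φ ψ ∈ w ↔ φ ∈ w ∧ ψ ∈ w :=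
  ⟨fun h => ⟨w.isTheory.mp (w.thm (.conjLeft _ _)) h, w.isTheory.mp (w.thm (.conjRight _ _)) h⟩,
    fun h => w.isTheory.mp (w.isTheory.mp (w.thm (.conjIntro _ _)) h.1) h.2⟩

@[simp] theorem mem_imp : imp φ ψ ∈ w ↔ (φ ∈ w → ψ ∈ w) := by
  simp [imp]

@[simp] theorem mem_iff : Formula.iff φ ψ ∈ w ↔ (φ ∈ w ↔ ψ ∈ w) := by
  simp [Formula.iff, iff_def]

@[simp] theorem mem_eq_self (x : Var) : eq x x ∈ w := w.thm (.eqRef x)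

@[simp] theorem mem_ne {x y : Var} : ne x y ∈ w ↔ eq x y ∉ w := by simp [ne]

@[simp] theorem not_mem_bot : bot ∉ w := by simp [bot]

@[simp] theorem mem_top : top ∈ w := by simp [top]

@[simp] theorem mem_sept : sept φ ψ ∈ w ↔ wand φ (neg ψ) ∉ w := by simp [sept]

end World

/-- Completeness with respect to worlds. -/
theorem provable_of_forall_world {φ : Formula} (h : ∀ w : World, φ ∈ w) : Provable φ := by
  by_contra hφ
  obtain ⟨w, -, hw⟩ := isTheory_provable.exists_world hφ
  exact hw (h w)

theorem imp_of_forall_world {φ ψ : Formula} (h : ∀ w : World, φ ∈ w → ψ ∈ w) :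
    Provable (imp φ ψ) :=
  provable_of_forall_world fun w => World.mem_imp.2 (h w)

/-! ### Separating connectives and composition of worlds -/

namespace World

variable {w a b c d e : World} {φ φ' ψ ψ' χ : Formula}

theorem mem_of_imp (h : Provable (imp φ ψ)) (hφ : φ ∈ w) : ψ ∈ w := mem_imp.1 (w.thm h) hφ

theorem star_comm (h : star φ ψ ∈ w) : star ψ φ ∈ w := (mem_iff.1 (w.thm (.starComm φ ψ))).1 h

theorem star_mono_left (h : ∀ v : World, φ ∈ v → φ' ∈ v) (hw : star φ ψ ∈ w) : star φ' ψ ∈ w :=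
  mem_of_imp (.starIntro ψ (imp_of_forall_world h)) hw

theorem star_mono_right (h : ∀ v : World, ψ ∈ v → ψ' ∈ v) (hw : star φ ψ ∈ w) : star φ ψ' ∈ w :=
  star_comm (star_mono_left h (star_comm hw))

theorem star_mono (h : ∀ v : World, φ ∈ v → φ' ∈ v) (h' : ∀ v : World, ψ ∈ v → ψ' ∈ v)
    (hw : star φ ψ ∈ w) : star φ' ψ' ∈ w :=
  star_mono_left h (star_mono_right h' hw)

/-- If `star φ ψ` entails `χ` in all worlds then `φ` entails `wand ψ χ`. -/
theorem wand_of_star (h : ∀ v : World, star φ ψ ∈ v → χ ∈ v) (hw : φ ∈ w) : wand ψ χ ∈ w :=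
  mem_of_imp (.starAdj (imp_of_forall_world h)) hw

theorem star_of_wand (h : ∀ v : World, φ ∈ v → wand ψ χ ∈ v) (hw : star φ ψ ∈ w) : χ ∈ w :=
  mem_of_imp (.wandAdj (imp_of_forall_world h)) hw

theorem wand_star (hw : star (wand φ ψ) φ ∈ w) : ψ ∈ w := star_of_wand (fun _ h => h) hw

theorem not_mem_star_left (h : ∀ v : World, φ ∉ v) : star φ ψ ∉ w := fun hw =>
  not_mem_bot (star_of_wand (χ := bot) (fun v hv => absurd hv (h v)) hw)

theorem not_mem_star_right (h : ∀ v : World, ψ ∉ v) : star φ ψ ∉ w := fun hw =>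
  not_mem_star_left h (star_comm hw)

/-- The separating conjunction distributes over case distinctions. -/
theorem star_cases_left (h : ∀ v : World, χ ∈ v → φ ∈ v ∨ φ' ∈ v) (hw : star χ ψ ∈ w) :
    star φ ψ ∈ w ∨ star φ' ψ ∈ w := by
  by_contra hn
  have key : ∀ v : World, χ ∈ v → wand ψ (imp (neg (star φ ψ)) (star φ' ψ)) ∈ v := by
    intro v hv
    rcases h v hv with h | h
    · exact wand_of_star (fun u hu => by simp [hu]) h
    · exact wand_of_star (fun u hu => by simp [hu]) h
  have := star_of_wand key hw
  simp only [mem_imp, mem_neg] at this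
  tauto

theorem star_cases_right (h : ∀ v : World, χ ∈ v → φ ∈ v ∨ φ' ∈ v) (hw : star ψ χ ∈ w) :
    star ψ φ ∈ w ∨ star ψ φ' ∈ w :=
  (star_cases_left h (star_comm hw)).imp star_comm star_comm

/-- `Rel w a b`: the world `w` is a composition of the worlds `a` and `b`. -/
def Rel (w a b : World) : Prop := ∀ φ ∈ a, ∀ ψ ∈ b, star φ ψ ∈ w

theorem Rel.symm (h : Rel w a b) : Rel w b a := fun _ hφ _ hψ => star_comm (h _ hψ _ hφ)

/-- If `P` is closed under entailment, distributes over disjunction, and holds of `⊤` but not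
of `⊥`, then some world consists only of formulae that satisfy `P`. -/
theorem exists_rel_right {P : Formula → Prop} (hmono : ∀ {φ ψ}, (∀ v : World, φ ∈ v → ψ ∈ v) →
      P φ → P ψ) (hor : ∀ {φ ψ}, P (neg (conj φ ψ)) → P (neg φ) ∨ P (neg ψ))
    (htop : P top) (hbot : ¬ P bot) : ∃ b : World, ∀ ψ ∈ b, P ψ := by
  -- The formulae whose negation violates `P` form a filter, because `P` distributes over
  -- disjunction. A world `b` above it works: if `ψ ∈ b` violated `P`, then `neg ψ` would lie in the
  -- filter.
  have hT : IsTheory {χ | ¬ P (neg χ)} := by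
    refine ⟨fun {χ} h hP => hbot (hmono (fun v hv => ?_) hP), fun {χ ξ} h₁ h₂ hP => ?_⟩
    · exact absurd (v.thm h) (mem_neg.1 hv)
    · refine (hor (hmono (fun v hv => ?_) hP)).elim h₁ h₂
      simp only [mem_neg, mem_conj, mem_imp] at hv ⊢
      tauto
  obtain ⟨b, hb, -⟩ := hT.exists_world (ψ := bot)
    (not_not.2 (hmono (fun v _ => by simp) htop))
  refine ⟨b, fun ψ hψ => ?_⟩
  by_contra h
  exact mem_neg.1 (hb (neg ψ) fun hP => h (hmono (fun v hv => by simpa using hv) hP)) hψ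

theorem exists_right (h : star φ ψ ∈ w) : ∃ b : World, ψ ∈ b ∧ ∀ χ ∈ b, star φ χ ∈ w := by
  obtain ⟨b, hb⟩ := exists_rel_right (P := fun χ => star φ (conj ψ χ) ∈ w)
    (fun h => star_mono_right fun v hv => by
      simp only [mem_conj] at hv ⊢
      exact ⟨hv.1, h v hv.2⟩)
    (fun h => star_cases_right (fun v hv => by
      simp only [mem_conj, mem_neg] at hv ⊢
      tauto) h)
    (star_mono_right (fun v hv => by simpa using hv) h)
    (not_mem_star_right fun v hv => by simp at hv)
  refine ⟨b, ?_, fun χ hχ => star_mono_right (fun v hv => (mem_conj.1 hv).2) (hb χ hχ)⟩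
  by_contra hn
  exact not_mem_star_right (fun v hv => by simp at hv) (hb _ (mem_neg.2 hn))

/-- The two worlds are chosen in turn: `a` against the single formula `ψ`, then `b` against all of
`a`. For the second choice, two failures at `α` and `α'` are merged into one at `conj α α'`, since
`a` is closed under conjunction. -/
theorem exists_rel_of_star (h : star φ ψ ∈ w) : ∃ a b, Rel w a b ∧ φ ∈ a ∧ ψ ∈ b := by
  obtain ⟨a, ha, hw⟩ := exists_right (star_comm h)
  obtain ⟨b, hb⟩ := exists_rel_right (P := fun χ => ∀ α ∈ a, star α (conj ψ χ) ∈ w)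
    (fun h hP α hα => star_mono_right (fun v hv => by
      simp only [mem_conj] at hv ⊢
      exact ⟨hv.1, h v hv.2⟩) (hP α hα))
    (fun {χ ξ} h => by
      by_contra hn
      push Not at hn
      obtain ⟨⟨α, hα, h₁⟩, α', hα', h₂⟩ := hn
      rcases star_cases_right (φ := conj ψ (neg χ)) (φ' := conj ψ (neg ξ)) (fun v hv => by
        simp only [mem_conj, mem_neg] at hv ⊢
        tauto) (h (conj α α') (mem_conj.2 ⟨hα, hα'⟩)) with h | h
      · exact h₁ (star_mono_left (fun v hv => (mem_conj.1 hv).1) h)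
      · exact h₂ (star_mono_left (fun v hv => (mem_conj.1 hv).2) h))
    (fun α hα => star_mono_right (fun v hv => by simpa using hv) (star_comm (hw α hα)))
    (fun h => not_mem_star_right (fun v hv => by simp at hv) (h top mem_top))
  refine ⟨a, b, fun α hα χ hχ => star_mono_right (fun v hv => (mem_conj.1 hv).2) (hb χ hχ α hα),
    ha, ?_⟩
  by_contra hn
  exact not_mem_star_right (fun v hv => by simp at hv) (hb _ (mem_neg.2 hn) top mem_top)

/-- Existence of the worlds that witness a septraction. -/
theorem exists_rel_of_sept (h : sept φ ψ ∈ w) : ∃ a c, Rel c w a ∧ φ ∈ a ∧ ψ ∈ c := by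
  have wmono : ∀ {φ φ' ψ}, (∀ v : World, φ ∈ v → φ' ∈ v) → wand φ' ψ ∈ w → wand φ ψ ∈ w :=
    fun h => wand_of_star fun v hv => wand_star (star_mono_right h hv)
  -- No member of `a`, even conjoined with `φ`, is one whose addition to `w` forces `neg ψ`.
  obtain ⟨a, ha⟩ := exists_rel_right (P := fun χ => wand (conj φ χ) (neg ψ) ∉ w)
    (fun h hP hw => hP (wmono (fun v hv => by
      simp only [mem_conj] at hv ⊢
      exact ⟨hv.1, h v hv.2⟩) hw))
    (fun {χ ξ} h => by
      by_contra hn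
      push Not at hn
      refine h (wand_of_star (φ := conj (wand (conj φ (neg χ)) (neg ψ))
        (wand (conj φ (neg ξ)) (neg ψ))) (fun v hv => ?_) (mem_conj.2 hn))
      rcases star_cases_right (φ := conj φ (neg χ)) (φ' := conj φ (neg ξ)) (fun v hv => by
        simp only [mem_conj, mem_neg] at hv ⊢
        tauto) hv with h | h
      · exact wand_star (star_mono_left (fun v hv => (mem_conj.1 hv).1) h)
      · exact wand_star (star_mono_left (fun v hv => (mem_conj.1 hv).2) h))
    (fun hw => mem_sept.1 h (wmono (fun v hv => by simpa using hv) hw))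
    (fun hn => hn (wand_of_star (φ := top)
      (fun v hv => absurd hv (not_mem_star_right fun u hu => by simp at hu)) mem_top))
  have hφ : φ ∈ a := by
    by_contra hn
    exact ha _ (mem_neg.2 hn) (wand_of_star (φ := top)
      (fun v hv => absurd hv (not_mem_star_right fun u hu => by simp at hu)) mem_top)
  -- The theory generated by `ψ` and all `star ω α`. Were it inconsistent, some `ω ∈ w` would entail
  -- `wand α (neg ψ)`, against the choice of `a`.
  have hT : IsTheory {χ | ∃ ω ∈ w, ∃ α ∈ a, ∀ v : World, star ω α ∈ v → ψ ∈ v → χ ∈ v} := by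
    refine ⟨fun h => ⟨top, mem_top, top, mem_top, fun v _ _ => v.thm h⟩, ?_⟩
    rintro χ ξ ⟨ω, hω, α, hα, h₁⟩ ⟨ω', hω', α', hα', h₂⟩
    refine ⟨conj ω ω', mem_conj.2 ⟨hω, hω'⟩, conj α α', mem_conj.2 ⟨hα, hα'⟩, fun v hv hψ => ?_⟩
    exact mem_imp.1 (h₁ v (star_mono (fun u hu => (mem_conj.1 hu).1)
      (fun u hu => (mem_conj.1 hu).1) hv) hψ) (h₂ v (star_mono (fun u hu => (mem_conj.1 hu).2)
      (fun u hu => (mem_conj.1 hu).2) hv) hψ)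
  obtain ⟨c, hc, -⟩ := hT.exists_world (ψ := bot) (by
    rintro ⟨ω, hω, α, hα, h⟩
    refine ha α hα (wand_of_star (φ := ω) (fun v hv => mem_neg.2 fun hψ => ?_) hω)
    exact not_mem_bot (h v (star_mono_right (fun u hu => (mem_conj.1 hu).2) hv) hψ))
  exact ⟨a, c, fun ω hω α hα => hc _ ⟨ω, hω, α, hα, fun v hv _ => hv⟩, hφ,
    hc _ ⟨top, mem_top, top, mem_top, fun v _ hv => hv⟩⟩

theorem Rel.mem_sept (h : Rel c w a) (hφ : φ ∈ a) (hψ : ψ ∈ c) : sept φ ψ ∈ w := by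
  rw [World.mem_sept]
  exact fun hw => mem_neg.1 (wand_star (h _ hw _ hφ)) hψ

theorem exists_unit (w : World) : ∃ e, Rel w w e ∧ emp ∈ e := by
  obtain ⟨a, e, h, -, he⟩ := exists_rel_of_star
    ((mem_iff.1 (w.thm (.starEmp top))).1 mem_top)
  refine ⟨e, fun φ hφ ψ hψ => h φ ?_ ψ hψ, he⟩
  by_contra hn
  exact mem_neg.1 ((mem_iff.1 (w.thm (.starEmp (neg φ)))).2 (h _ (mem_neg.2 hn) _ he)) hφ

/-- Composition of worlds is associative. -/
theorem Rel.assoc (h : Rel d c b) (h' : Rel c w a) : ∃ e, Rel e a b ∧ Rel d w e := by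
  -- Carrying `star α β` inside the conjunction forces every such formula into `e`, making `e` a
  -- composition of `a` and `b`.
  obtain ⟨e, he⟩ := exists_rel_right
    (P := fun χ => ∀ ω ∈ w, ∀ α ∈ a, ∀ β ∈ b, star ω (conj (star α β) χ) ∈ d)
    (fun h hP ω hω α hα β hβ => star_mono_right (fun v hv => by
      simp only [mem_conj] at hv ⊢
      exact ⟨hv.1, h v hv.2⟩) (hP ω hω α hα β hβ))
    (fun {χ ξ} h => by
      by_contra hn
      push Not at hn
      obtain ⟨⟨ω, hω, α, hα, β, hβ, h₁⟩, ω', hω', α', hα', β', hβ', h₂⟩ := hn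
      rcases star_cases_right (φ := conj (star (conj α α') (conj β β')) (neg χ))
        (φ' := conj (star (conj α α') (conj β β')) (neg ξ)) (fun v hv => by
        simp only [mem_conj, mem_neg] at hv ⊢
        tauto) (h (conj ω ω') (mem_conj.2 ⟨hω, hω'⟩) (conj α α') (mem_conj.2 ⟨hα, hα'⟩)
          (conj β β') (mem_conj.2 ⟨hβ, hβ'⟩)) with h | h
      · refine h₁ (star_mono (fun v hv => (mem_conj.1 hv).1) (fun v hv => ?_) h)
        exact mem_conj.2 ⟨star_mono (fun u hu => (mem_conj.1 hu).1)
          (fun u hu => (mem_conj.1 hu).1) (mem_conj.1 hv).1, (mem_conj.1 hv).2⟩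
      · refine h₂ (star_mono (fun v hv => (mem_conj.1 hv).2) (fun v hv => ?_) h)
        exact mem_conj.2 ⟨star_mono (fun u hu => (mem_conj.1 hu).2)
          (fun u hu => (mem_conj.1 hu).2) (mem_conj.1 hv).1, (mem_conj.1 hv).2⟩)
    (fun ω hω α hα β hβ => star_mono_right (fun v hv => by simpa using hv)
      ((mem_iff.1 (d.thm (.starAssoc ω α β))).1 (h _ (h' ω hω α hα) β hβ)))
    (fun h => not_mem_star_right (fun v hv => by simp at hv)
      (h top mem_top top mem_top top mem_top))
  refine ⟨e, fun α hα β hβ => ?_, fun ω hω χ hχ => star_mono_right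
    (fun v hv => (mem_conj.1 hv).2) (he χ hχ ω hω top mem_top top mem_top)⟩
  by_contra hn
  exact not_mem_star_right (fun v hv => by simp at hv)
    (he _ (mem_neg.2 hn) top mem_top α hα β hβ)

end World

/-! ### Laws of the core formulae in worlds and along composition -/

namespace World

variable {w a b c d e : World} {φ : Formula} {x y z : Var} {β β' : ℕ}

@[simp] theorem mem_bigConj {l : List Formula} : bigConj l ∈ w ↔ ∀ φ ∈ l, φ ∈ w := by
  induction l with
  | nil => simp [bigConj]
  | cons φ l ih =>
    cases l with
    | nil => simp [bigConj]
    | cons ψ l => rw [bigConj, mem_conj, ih]; simp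

/-! ### Equalities -/

theorem mem_subst (h : eq x y ∈ w) (hφ : φ ∈ w) : subst y x φ ∈ w :=
  mem_of_imp (.eqSub φ x y) (mem_conj.2 ⟨hφ, h⟩)

theorem eq_symm (h : eq x y ∈ w) : eq y x ∈ w := by
  by_contra hn
  have := mem_subst h (mem_neg.2 hn)
  by_cases hxy : x = y <;> simp_all [subst]

theorem eq_trans (h : eq x y ∈ w) (h' : eq y z ∈ w) : eq x z ∈ w := by
  by_cases hzy : z = y
  · rwa [hzy]
  · simpa [subst, hzy] using mem_subst h h'

theorem alloc_congr (h : eq x y ∈ w) (hx : alloc x ∈ w) : alloc y ∈ w := by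
  have := mem_subst (eq_symm h) hx
  simp only [alloc, bot, ne, subst, if_true] at this
  -- The substitution also acts on the variable of `bot`, so the conclusion of the wand is `z ≠ z`
  -- for some `z`, possibly not `0`; it is still contradictory.
  exact wand_of_star (fun v hv => absurd (wand_star hv) (by simp)) this

theorem pts_congr_left (h : eq x y ∈ w) (hx : pts x z ∈ w) : pts y z ∈ w := by
  by_cases hzx : z = x
  · subst hzx
    have := mem_subst (eq_symm h) hx
    simp only [subst, if_true] at this
    -- Substitution replaces both occurrences in `pts z z`, giving only `pts y y`; applied to the
    -- negated goal it gives the negation of the same formula.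
    by_contra hn
    have := mem_subst (eq_symm h) (mem_neg.2 hn)
    by_cases hyz : y = z <;> simp_all [subst]
  · simpa [subst, hzx] using mem_subst (eq_symm h) hx

theorem pts_congr_right (h : eq x y ∈ w) (hx : pts z x ∈ w) : pts z y ∈ w := by
  by_cases hzx : z = x
  · subst hzx
    have := mem_subst (eq_symm h) hx
    simp only [subst, if_true] at this
    exact pts_congr_left (eq_symm h) this
  · simpa [subst, hzx] using mem_subst (eq_symm h) hx

theorem alloc_of_pts (h : pts x y ∈ w) : alloc x ∈ w := mem_of_imp (.pointAlloc x y) h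

theorem eq_of_pts (h : pts x y ∈ w) (h' : pts x z ∈ w) : eq y z ∈ w :=
  mem_of_imp (.pointInj x y z) (mem_conj.2 ⟨h, h'⟩)

/-! ### Core formulae and composition -/

theorem Rel.eq_left (h : Rel c a b) : eq x y ∈ a ↔ eq x y ∈ c := by
  refine ⟨fun he => mem_of_imp (.monoEq x y) (h _ he _ mem_top), fun he => ?_⟩
  by_contra hn
  exact mem_ne.1 (mem_of_imp (.monoNe x y) (h _ (mem_ne.2 hn) _ mem_top)) he

theorem Rel.eq_right (h : Rel c a b) : eq x y ∈ b ↔ eq x y ∈ c := h.symm.eq_left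

theorem Rel.pts_left (h : Rel c a b) (hp : pts x y ∈ a) : pts x y ∈ c :=
  mem_of_imp (.monoPts x y) (h _ hp _ mem_top)

theorem Rel.not_alloc_right (h : Rel c a b) (ha : alloc x ∈ a) : alloc x ∉ b := fun hb =>
  not_mem_bot ((mem_iff.1 (c.thm (.doubleAlloc x))).1 (h _ ha _ hb))

/-- Comes from the definition of `alloc` as a wand: in `(alloc x * ⊤) * (x ↪ x)` the outer factors
can be regrouped, and together they give `⊥`. -/
theorem Rel.alloc_left (h : Rel c a b) (ha : alloc x ∈ a) : alloc x ∈ c := by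
  refine wand_of_star (φ := star (alloc x) top) (fun v hv => ?_) (h _ ha _ mem_top)
  have := (mem_iff.1 (v.thm (.starAssoc _ _ _))).1 hv
  have := (mem_iff.1 (v.thm (.starAssoc _ _ _))).2 (star_mono_right (fun _ h => star_comm h) this)
  exact absurd this (not_mem_star_left fun u hu => not_mem_bot (wand_star hu))

theorem Rel.alloc_iff (h : Rel c a b) : alloc x ∈ c ↔ alloc x ∈ a ∨ alloc x ∈ b := by
  refine ⟨fun hc => ?_, fun hab => hab.elim h.alloc_left h.symm.alloc_left⟩
  by_contra hn
  rw [not_or, ← mem_neg, ← mem_neg] at hn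
  exact mem_neg.1 (mem_of_imp (.allocNeg x) (h _ hn.1 _ hn.2)) hc

theorem Rel.pts_iff_left (h : Rel c a b) (ha : alloc x ∈ a) : pts x y ∈ c ↔ pts x y ∈ a := by
  refine ⟨fun hc => ?_, h.pts_left⟩
  by_contra hn
  exact mem_neg.1 (mem_of_imp (.pointsNeg x y)
    (h _ (mem_conj.2 ⟨ha, mem_neg.2 hn⟩) _ mem_top)) hc

theorem Rel.pts_iff (h : Rel c a b) : pts x y ∈ c ↔ pts x y ∈ a ∨ pts x y ∈ b := by
  refine ⟨fun hc => ?_, fun hab => hab.elim h.pts_left h.symm.pts_left⟩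
  rcases h.alloc_iff.1 (alloc_of_pts hc) with ha | hb
  · exact .inl ((h.pts_iff_left ha).1 hc)
  · exact .inr ((h.symm.pts_iff_left hb).1 hc)

/-! ### Sizes -/

@[simp] theorem sizeGe_zero : sizeGe 0 ∈ w := mem_top

theorem Rel.not_emp_left (h : Rel c a b) (ha : neg emp ∈ a) : neg emp ∈ c :=
  mem_of_imp .monoNotEmp (h _ ha _ mem_top)

/-- Associativity of the composition of worlds, in the other direction. -/
theorem Rel.assoc' (h : Rel c a b) (h' : Rel b d e) : ∃ f, Rel f a d ∧ Rel c f e := by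
  obtain ⟨f, hf, hc⟩ := h.symm.assoc h'.symm
  exact ⟨f, hf.symm, hc.symm⟩

theorem Rel.sizeGe_right (h : Rel c a b) (hb : sizeGe β ∈ b) : sizeGe β ∈ c := by
  match β with
  | 0 => simp
  | 1 => exact h.symm.not_emp_left hb
  | β + 2 =>
    obtain ⟨d, e, hde, hd, he⟩ := exists_rel_of_star hb
    obtain ⟨f, hf, hc⟩ := h.assoc' hde
    exact hc _ (hf.symm.not_emp_left hd) _ he

theorem Rel.sizeGe_succ (h : Rel c a b) (ha : neg emp ∈ a) (hb : sizeGe β ∈ b) :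
    sizeGe (β + 1) ∈ c := by
  match β with
  | 0 => exact h.not_emp_left ha
  | β + 1 => exact h _ ha _ hb

theorem Rel.sizeGe_add (h : Rel c a b) (ha : sizeGe β ∈ a) (hb : sizeGe β' ∈ b) :
    sizeGe (β + β') ∈ c := by
  induction β generalizing c a b with
  | zero => simpa using h.sizeGe_right hb
  | succ β ih =>
    match β with
    | 0 => simpa [add_comm] using h.sizeGe_succ ha hb
    | β + 1 =>
      obtain ⟨d, e, hde, hd, he⟩ := exists_rel_of_star ha
      obtain ⟨f, hf, hc⟩ := h.symm.assoc' hde.symm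
      have := hc.symm.sizeGe_succ hd (ih hf.symm he hb)
      rwa [show β + 1 + 1 + β' = β + 1 + β' + 1 by omega]

/-- Sizes at most `β - 1` and `β' - 1` add up to at most `β + β' - 2`. -/
theorem Rel.not_sizeGe (h : Rel c a b) (ha : sizeGe β ∉ a) (hb : sizeGe β' ∉ b) :
    sizeGe (β + β' - 1) ∉ c :=
  mem_neg.1 (mem_of_imp (.sizeNeg β β') (h _ (mem_neg.2 ha) _ (mem_neg.2 hb)))

theorem sizeGe_of_succ (h : sizeGe (β + 1) ∈ w) : sizeGe β ∈ w := by
  match β with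
  | 0 => simp
  | β + 1 =>
    obtain ⟨a, b, hab, -, hb⟩ := exists_rel_of_star h
    exact hab.sizeGe_right hb

theorem sizeGe_anti (h : sizeGe β' ∈ w) (hle : β ≤ β') : sizeGe β ∈ w := by
  induction hle with
  | refl => exact h
  | step _ ih => exact ih (sizeGe_of_succ h)

theorem eq_of_alloc (hs : sizeGe 2 ∉ w) (hx : alloc x ∈ w) (hy : alloc y ∈ w) : eq x y ∈ w := by
  by_contra hn
  exact hs (mem_of_imp (.sizeTwo x y) (by simp [*]))

/-- Induction on `Y`, splitting off a one-cell world that allocates `r`. Variables not equal to `r`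
cannot be allocated in that cell, so they stay allocated in the remainder. -/
theorem sizeGe_card (Y : Finset Var) (hY : ∀ x ∈ Y, alloc x ∈ w)
    (hne : ∀ x ∈ Y, ∀ y ∈ Y, eq x y ∈ w → x = y) : sizeGe Y.card ∈ w := by
  induction Y using Finset.induction_on generalizing w with
  | empty => simp
  | insert r Y hr ih =>
    obtain ⟨a, b, hab, ha, -⟩ :=
      exists_rel_of_star (mem_of_imp (.allocSizeOne r) (hY r (Finset.mem_insert_self r Y)))
    simp only [sizeEq, mem_conj, mem_neg] at ha
    rw [Finset.card_insert_of_notMem hr]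
    refine hab.sizeGe_succ ha.2.1 (ih (fun x hx => ?_) fun x hx y hy h =>
      hne x (Finset.mem_insert_of_mem hx) y (Finset.mem_insert_of_mem hy) (hab.eq_right.1 h))
    refine (hab.alloc_iff.1 (hY x (Finset.mem_insert_of_mem hx))).resolve_left fun hxa => hr ?_
    rwa [hne r (Finset.mem_insert_self r Y) x (Finset.mem_insert_of_mem hx)
      (hab.eq_left.1 (eq_of_alloc ha.2.2 ha.1 hxa))]

end World

/-! ### Core models, from worlds and from memory states -/

/-- The laws obeyed by the core formulae that hold in a memory state. -/
structure IsCoreModel (T : Core → Prop) : Prop where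
  eq_refl : ∀ x, T (.eq x x)
  eq_symm : ∀ {x y}, T (.eq x y) → T (.eq y x)
  eq_trans : ∀ {x y z}, T (.eq x y) → T (.eq y z) → T (.eq x z)
  alloc_congr : ∀ {x y}, T (.eq x y) → T (.alloc x) → T (.alloc y)
  pts_congr : ∀ {x y z}, T (.eq x y) → T (.pts x z) → T (.pts y z)
  pts_congr_right : ∀ {x y z}, T (.eq x y) → T (.pts z x) → T (.pts z y)
  alloc_of_pts : ∀ {x y}, T (.pts x y) → T (.alloc x)
  eq_of_pts : ∀ {x y z}, T (.pts x y) → T (.pts x z) → T (.eq y z)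
  size_zero : T (.size 0)
  size_anti : ∀ {β β'}, T (.size β') → β ≤ β' → T (.size β)
  size_card : ∀ Y : Finset Var, (∀ x ∈ Y, T (.alloc x)) →
    (∀ x ∈ Y, ∀ y ∈ Y, T (.eq x y) → x = y) → T (.size Y.card)

theorem World.isCoreModel (w : World) : IsCoreModel fun c => c.toFormula ∈ w where
  eq_refl := mem_eq_self
  eq_symm := World.eq_symm
  eq_trans := World.eq_trans
  alloc_congr := World.alloc_congr
  pts_congr := pts_congr_left
  pts_congr_right := World.pts_congr_right
  alloc_of_pts := World.alloc_of_pts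
  eq_of_pts := World.eq_of_pts
  size_zero := mem_top
  size_anti := sizeGe_anti
  size_card := sizeGe_card

namespace Heap

/-- The heap with a single cell. -/
def single (l m : Loc) : Heap where
  map k := if k = l then some m else none
  finite_dom := (Set.finite_singleton l).subset fun k hk => by
    by_contra h
    exact hk (if_neg h)

theorem dom_single (l m : Loc) : (single l m).dom = {l} := by
  ext k
  simp [dom, single]

theorem dom_add (h₁ h₂ : Heap) : (h₁.add h₂).dom = h₁.dom ∪ h₂.dom := by
  ext l
  by_cases h : h₁.map l = none
  · simp [dom, add, h]
  · obtain ⟨m, hm⟩ := Option.ne_none_iff_exists'.1 h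
    simp [dom, add, hm]

theorem ext {h₁ h₂ : Heap} (h : ∀ l, h₁.map l = h₂.map l) : h₁ = h₂ := by
  cases h₁; cases h₂
  congr
  exact funext h

/-- The restriction of a heap to a set of locations. -/
def restrict (h : Heap) (s : Set Loc) [DecidablePred (· ∈ s)] : Heap where
  map l := if l ∈ s then h.map l else none
  finite_dom := h.finite_dom.subset fun l hl => by
    by_contra hn
    exact hl (by simp_all)

end Heap

theorem sat_alloc {s : Store} {h : Heap} {x : Var} : Sat s h (alloc x) ↔ s x ∈ h.dom := by
  simp only [alloc, bot, ne, Sat, not_true, imp_false]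
  refine ⟨fun H => ?_, fun H h₁ hd h₁x => ?_⟩
  · by_contra hn
    -- If `s x` is unallocated, the one-cell loop at `s x` is a disjoint heap refuting the wand.
    refine H (.single (s x) (s x)) ?_ (by simp [Heap.single])
    simpa [Heap.Disj, Heap.dom_single] using hn
  · exact Set.disjoint_left.1 hd (show s x ∈ h₁.dom by simp [Heap.dom, h₁x]) H

theorem sat_sizeGe {s : Store} {h : Heap} {β : ℕ} : Sat s h (sizeGe β) ↔ β ≤ h.dom.ncard := by
  have hfin : ∀ h : Heap, h.dom.Finite := Heap.finite_dom
  match β with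
  | 0 => simp [sizeGe, top, bot, ne, Sat]
  | 1 =>
    simp only [sizeGe, Sat, Nat.one_le_iff_ne_zero, ne_eq, Set.ncard_eq_zero (hfin h)]
  | β + 2 =>
    have ih : ∀ h : Heap, Sat s h (sizeGe (β + 1)) ↔ β + 1 ≤ h.dom.ncard := fun h => sat_sizeGe
    simp only [sizeGe, Sat, ih]
    constructor
    · rintro ⟨h₁, h₂, hd, rfl, h₁e, h₂c⟩
      rw [Heap.dom_add, Set.ncard_union_eq hd (hfin _) (hfin _)]
      have := (Set.ncard_eq_zero (hfin h₁)).not.2 h₁e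
      omega
    · intro hc
      obtain ⟨l, hl⟩ : h.dom.Nonempty := (Set.ncard_pos (hfin h)).1 (by omega)
      classical
      have h₁ : (h.restrict {l}).dom = {l} := by
        ext k
        by_cases hk : k = l
        · subst hk; simpa [Heap.dom, Heap.restrict] using hl
        · simp [Heap.dom, Heap.restrict, hk]
      have h₂ : (h.restrict {l}ᶜ).dom = h.dom \ {l} := by
        ext k
        by_cases hk : k = l <;> simp [Heap.dom, Heap.restrict, hk]
      refine ⟨h.restrict {l}, h.restrict {l}ᶜ, ?_, Heap.ext fun k => ?_, ?_, ?_⟩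
      · rw [Heap.Disj, h₁, h₂]
        exact Set.disjoint_sdiff_right
      · by_cases hk : k = l <;> simp [Heap.add, Heap.restrict, hk]
      · simp [h₁]
      · rw [h₂, Set.ncard_sdiff_singleton_of_mem hl]
        omega

theorem isCoreModel_sat (s : Store) (h : Heap) : IsCoreModel fun c => Sat s h c.toFormula where
  eq_refl _ := rfl
  eq_symm := Eq.symm
  eq_trans := Eq.trans
  alloc_congr {x y} e hx := by
    simp only [Core.toFormula, sat_alloc, Sat] at *
    rwa [← e]
  pts_congr {x y z} e hx := by
    simp only [Core.toFormula, Sat] at *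
    rwa [← e]
  pts_congr_right {x y z} e hx := by
    simp only [Core.toFormula, Sat] at *
    rwa [← e]
  alloc_of_pts {x y} hx := by
    simp only [Core.toFormula, Sat, sat_alloc] at *
    simp [Heap.dom, hx]
  eq_of_pts {x y z} h₁ h₂ := by
    simp only [Core.toFormula, Sat] at *
    exact Option.some.inj (h₁.symm.trans h₂)
  size_zero := by simp [Core.toFormula, sat_sizeGe]
  size_anti h₁ h₂ := by
    simp only [Core.toFormula, sat_sizeGe] at *
    exact h₂.trans h₁
  size_card Y h₁ h₂ := by
    simp only [Core.toFormula, sat_sizeGe, sat_alloc, Sat] at *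
    -- The store is injective on `Y`, so `Y` names that many distinct allocated locations.
    rw [← Finset.card_image_of_injOn (f := s) fun x hx y hy => h₂ x hx y hy,
      ← Set.ncard_coe_finset]
    exact Set.ncard_le_ncard (by simpa [Set.subset_def] using h₁) h.finite_dom

/-! ### Building a world of prescribed core type from one-cell worlds -/

/-- `a` has size `m`, allocates exactly the variables of `X` that are equal to one in `S`, and
these point as prescribed by `T`. -/
structure Covers (T : Core → Prop) (X S : Finset Var) (m : ℕ) (a : World) : Prop where
  size : sizeGe m ∈ a
  not_size : sizeGe (m + 1) ∉ a
  alloc : ∀ r ∈ S, alloc r ∈ a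
  not_alloc : ∀ x ∈ X, (∀ r ∈ S, ¬ T (.eq r x)) → Formula.alloc x ∉ a
  pts : ∀ r ∈ S, ∀ y ∈ X, pts r y ∈ a ↔ T (.pts r y)

/-- `w` and `T` satisfy the same equalities between the variables in `X`. -/
def AgreeEq (T : Core → Prop) (X : Finset Var) (w : World) : Prop :=
  ∀ x ∈ X, ∀ y ∈ X, eq x y ∈ w ↔ T (.eq x y)

open World

section Covers

variable {T : Core → Prop} {X S S' : Finset Var} {m n k : ℕ} {w a b c : World} {r : Var}

theorem AgreeEq.rel_left (hw : AgreeEq T X w) (h : Rel w a b) : AgreeEq T X a :=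
  fun x hx y hy => h.eq_left.trans (hw x hx y hy)

theorem AgreeEq.of_rel (hw : AgreeEq T X a) (h : Rel w a b) : AgreeEq T X w :=
  fun x hx y hy => h.eq_left.symm.trans (hw x hx y hy)

theorem Covers.add (h : Covers T X S m a) (h' : Covers T X S' n b) (hr : Rel c a b) :
    Covers T X (S ∪ S') (m + n) c where
  size := hr.sizeGe_add h.size h'.size
  not_size := by
    have := hr.not_sizeGe h.not_size h'.not_size
    rwa [show m + 1 + (n + 1) - 1 = m + n + 1 by omega] at this
  alloc r hrS := (Finset.mem_union.1 hrS).elim (fun hS => hr.alloc_left (h.alloc r hS))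
    fun hS => hr.symm.alloc_left (h'.alloc r hS)
  not_alloc x hx hn := by
    rw [hr.alloc_iff, not_or]
    exact ⟨h.not_alloc x hx fun r hS => hn r (Finset.mem_union_left _ hS),
      h'.not_alloc x hx fun r hS => hn r (Finset.mem_union_right _ hS)⟩
  pts r hrS y hy := by
    rcases Finset.mem_union.1 hrS with hS | hS
    · rw [hr.pts_iff_left (h.alloc r hS), h.pts r hS y hy]
    · rw [hr.symm.pts_iff_left (h'.alloc r hS), h'.pts r hS y hy]

theorem exists_covers_empty (w : World) : ∃ a, Rel w w a ∧ Covers T X ∅ 0 a := by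
  obtain ⟨e, he, hemp⟩ := exists_unit w
  have hs : sizeGe 1 ∉ e := fun h => mem_neg.1 h hemp
  refine ⟨e, he, ⟨mem_top, hs, by simp, fun x _ _ hx => hs ?_, by simp⟩⟩
  simpa using sizeGe_card {x} (by simpa using hx) (by simp)

/-- Supplies padding: a cell at a location not named in `X`, used to raise the size without touching
allocation. -/
theorem exists_covers_free (w : World) : ∃ a c, Rel c w a ∧ Covers T X ∅ 1 a := by
  obtain ⟨a, c, h, ha, -⟩ := exists_rel_of_sept (w.thm (.wandSize X.toList))
  simp only [sizeEq, mem_conj, mem_neg, mem_bigConj, List.mem_map, Finset.mem_toList,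
    forall_exists_index, and_imp, forall_apply_eq_imp_iff₂] at ha
  exact ⟨a, c, h, ha.1.1, ha.1.2, by simp, fun x hx _ => ha.2 x hx, by simp⟩

/-- The cell of `r` comes from `wandPointsTo` if `T` makes `r` point to a variable of `X`, and
otherwise from `wandAlloc` with the whole of `X` excluded as target. Having a single cell, it
allocates only variables equal to `r`. -/
theorem exists_covers_singleton (hT : IsCoreModel T) (hw : AgreeEq T X w) (hr : r ∈ X)
    (hrw : alloc r ∉ w) : ∃ a c, Rel c w a ∧ Covers T X {r} 1 a := by
  have key : ∀ {a c}, Rel c w a → sizeEq 1 ∈ a → alloc r ∈ a →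
      (∀ y ∈ X, pts r y ∈ a ↔ T (.pts r y)) → Covers T X {r} 1 a := by
    intro a c h hs har hp
    simp only [sizeEq, mem_conj, mem_neg] at hs
    refine ⟨hs.1, hs.2, by simpa using har, fun x hx hn hxa => ?_, by simpa using hp⟩
    exact hn r (Finset.mem_singleton_self r)
      ((((hw.of_rel h).rel_left h.symm) r hr x hx).1 (eq_of_alloc hs.2 har hxa))
  by_cases hy : ∃ y ∈ X, T (.pts r y)
  · obtain ⟨y, hyX, hy⟩ := hy
    obtain ⟨a, c, h, ha, -⟩ := exists_rel_of_sept
      (mem_of_imp (.wandPointsTo r y) (mem_neg.2 hrw))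
    rw [mem_conj] at ha
    have haT : AgreeEq T X a := (hw.of_rel h).rel_left h.symm
    refine ⟨a, c, h, key h ha.2 (alloc_of_pts ha.1) fun z hz => ⟨fun hp => ?_, fun hp => ?_⟩⟩
    · exact hT.pts_congr_right ((haT y hyX z hz).1 (eq_of_pts ha.1 hp)) hy
    · exact pts_congr_right ((haT y hyX z hz).2 (hT.eq_of_pts hy hp)) ha.1
  · push Not at hy
    obtain ⟨a, c, h, ha, -⟩ := exists_rel_of_sept
      (mem_of_imp (.wandAlloc r X.toList) (mem_neg.2 hrw))
    simp only [mem_conj, mem_neg, mem_bigConj, List.mem_map, Finset.mem_toList,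
      forall_exists_index, and_imp, forall_apply_eq_imp_iff₂] at ha
    exact ⟨a, c, h, key h ha.1.2 ha.1.1 fun z hz => iff_of_false (ha.2 z hz) (hy z hz)⟩

/-- Any world can be extended by a world of a given size that allocates given variables. -/
theorem exists_covers (hT : IsCoreModel T) (hw : AgreeEq T X w) (hSX : S ⊆ X)
    (hS : ∀ r ∈ S, ∀ r' ∈ S, T (.eq r r') → r = r') (hSw : ∀ r ∈ S, alloc r ∉ w)
    (hk : S.card ≤ k) : ∃ a c, Rel c w a ∧ Covers T X S k a := by
  induction S using Finset.induction_on generalizing k with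
  | empty =>
    clear hSX hS hSw hk
    induction k with
    | zero =>
      obtain ⟨a, h, ha⟩ := exists_covers_empty (T := T) (X := X) w
      exact ⟨a, w, h, ha⟩
    | succ k ih =>
      obtain ⟨a, c, h, ha⟩ := ih
      obtain ⟨b, d, h', hb⟩ := exists_covers_free (T := T) (X := X) c
      obtain ⟨e, he, hd⟩ := h'.assoc h
      exact ⟨e, d, hd, by simpa using ha.add hb he⟩
  | insert r S hr ih =>
    rw [Finset.card_insert_of_notMem hr] at hk
    have hrX := hSX (Finset.mem_insert_self r S)
    obtain ⟨k, rfl⟩ : ∃ k', k = k' + 1 := ⟨k - 1, by omega⟩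
    obtain ⟨a, c, h, ha⟩ := ih (fun x hx => hSX (Finset.mem_insert_of_mem hx))
      (fun x hx y hy => hS x (Finset.mem_insert_of_mem hx) y (Finset.mem_insert_of_mem hy))
      (fun x hx => hSw x (Finset.mem_insert_of_mem hx)) (k := k) (by omega)
    -- Since `r` is equal to no variable already covered, its cell can still be added.
    have hrc : alloc r ∉ c := by
      rw [h.alloc_iff, not_or]
      refine ⟨hSw r (Finset.mem_insert_self r S), ha.not_alloc r hrX fun x hx he => hr ?_⟩
      rwa [← hS x (Finset.mem_insert_of_mem hx) r (Finset.mem_insert_self r S) he]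
    obtain ⟨b, d, h', hb⟩ := exists_covers_singleton hT (hw.of_rel h) hrX hrc
    obtain ⟨e, he, hd⟩ := h'.assoc h
    refine ⟨e, d, hd, ?_⟩
    have := ha.add hb he
    rwa [Finset.union_comm, ← Finset.insert_eq] at this

/-- The truth of the core formulae over `X` with bound `α` in a model `T` is realized by a world
that can be added to any world `w` with the same equalities and none of the allocated variables. -/
theorem exists_rel_coreFormulae {α : ℕ} (hα : X.card ≤ α) (hT : IsCoreModel T)
    (hw : AgreeEq T X w) (hwT : ∀ x ∈ X, T (.alloc x) → alloc x ∉ w) :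
    ∃ a c, Rel c w a ∧ ∀ κ ∈ coreFormulae X α, κ.toFormula ∈ a ↔ T κ := by
  classical
  -- The least variable of each equality class of allocated variables, so that each class receives
  -- exactly one cell.
  let S := X.filter fun x => T (.alloc x) ∧ ∀ y ∈ X, T (.eq x y) → x ≤ y
  have hSX : S ⊆ X := Finset.filter_subset _ _
  have hrep : ∀ x ∈ X, T (.alloc x) → ∃ r ∈ S, T (.eq r x) := by
    intro x hx hax
    have hne : (X.filter fun y => T (.eq x y)).Nonempty :=
      ⟨x, Finset.mem_filter.2 ⟨hx, hT.eq_refl x⟩⟩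
    obtain ⟨hrX, hxr⟩ := Finset.mem_filter.1 (Finset.min'_mem _ hne)
    exact ⟨_, Finset.mem_filter.2 ⟨hrX, hT.alloc_congr hxr hax, fun y hy hry =>
      Finset.min'_le _ _ (Finset.mem_filter.2 ⟨hy, hT.eq_trans hxr hry⟩)⟩, hT.eq_symm hxr⟩
  have hSalloc : ∀ r ∈ S, T (.alloc r) := fun r hr => (Finset.mem_filter.1 hr).2.1
  have hS : ∀ r ∈ S, ∀ r' ∈ S, T (.eq r r') → r = r' := fun r hr r' hr' h =>
    le_antisymm ((Finset.mem_filter.1 hr).2.2 r' (hSX hr') h)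
      ((Finset.mem_filter.1 hr').2.2 r (hSX hr) (hT.eq_symm h))
  -- The size prescribed by `T`, truncated at `α`, which core formulae of bound `α` cannot
  -- distinguish from larger sizes.
  let k := Nat.findGreatest (fun β => T (.size β)) α
  have hk : T (.size k) := Nat.findGreatest_spec (P := fun β => T (.size β)) α.zero_le hT.size_zero
  -- There is room for the cells of `S`: `S.card ≤ X.card ≤ α` and `T (.size S.card)`, hence `S.card
  -- ≤ k`.
  obtain ⟨a, c, h, ha⟩ := exists_covers hT hw hSX hS (fun r hr => hwT r (hSX hr) (hSalloc r hr))
    (k := k) (Nat.le_findGreatest ((Finset.card_le_card hSX).trans hα)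
      (hT.size_card S hSalloc hS))
  have haT : AgreeEq T X a := (hw.of_rel h).rel_left h.symm
  have halloc : ∀ x ∈ X, alloc x ∈ a ↔ T (.alloc x) := by
    refine fun x hx => ⟨fun hxa => ?_, fun hxT => ?_⟩
    · by_contra hn
      exact ha.not_alloc x hx (fun r hr he => hn (hT.alloc_congr he (hSalloc r hr))) hxa
    · obtain ⟨r, hr, he⟩ := hrep x hx hxT
      exact alloc_congr ((haT r (hSX hr) x hx).2 he) (ha.alloc r hr)
  have hpts : ∀ x ∈ X, ∀ y ∈ X, T (.alloc x) → (pts x y ∈ a ↔ T (.pts x y)) := by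
    intro x hx y hy hax
    obtain ⟨r, hr, he⟩ := hrep x hx hax
    have he' := (haT r (hSX hr) x hx).2 he
    exact ⟨fun hp => hT.pts_congr he
        ((ha.pts r hr y hy).1 (pts_congr_left (World.eq_symm he') hp)),
      fun hp => pts_congr_left he' ((ha.pts r hr y hy).2 (hT.pts_congr (hT.eq_symm he) hp))⟩
  refine ⟨a, c, h, fun κ hκ => ?_⟩
  match κ, hκ with
  | .eq x y, hκ => exact haT x hκ.1 y hκ.2
  | .alloc x, hκ => exact halloc x hκ
  | .pts x y, hκ =>
    exact ⟨fun hp => (hpts x hκ.1 y hκ.2 ((halloc x hκ.1).1 (alloc_of_pts hp))).1 hp,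
      fun hp => (hpts x hκ.1 y hκ.2 (hT.alloc_of_pts hp)).2 hp⟩
  | .size β, hκ =>
    refine ⟨fun hβ => hT.size_anti hk ?_, fun hβ => sizeGe_anti ha.size (Nat.le_findGreatest hκ hβ)⟩
    by_contra hlt
    exact ha.not_size (sizeGe_anti hβ (by omega))

end Covers

/-! ### Conjunctions of literals -/

theorem mem_litConj_toFormula {w : World} {φ : LitConj} :
    φ.toFormula ∈ w ↔ ∀ l ∈ φ.lits, l.toFormula ∈ w := by
  induction φ with
  | top => simp [LitConj.toFormula, LitConj.lits]
  | lit l => simp [LitConj.toFormula, LitConj.lits]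
  | and φ ψ ih₁ ih₂ =>
    simp only [LitConj.toFormula, LitConj.lits, mem_conj, ih₁, ih₂, Set.mem_union]
    grind

theorem sat_litConj {s : Store} {h : Heap} {φ : LitConj} (hφ : Sat s h φ.toFormula) :
    ∀ l ∈ φ.lits, Sat s h l.toFormula := by
  induction φ with
  | top => simp [LitConj.lits]
  | lit l => simpa [LitConj.toFormula, LitConj.lits] using hφ
  | and φ ψ ih₁ ih₂ => exact fun l hl => hl.elim (ih₁ hφ.1 l) (ih₂ hφ.2 l)

/-- The literals of `φ` hold in `T`. -/
def HoldsIn (T : Core → Prop) (φ : LitConj) : Prop :=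
  ∀ κ, (.pos κ ∈ φ.lits → T κ) ∧ (.neg κ ∈ φ.lits → ¬ T κ)

theorem holdsIn_world {w : World} {φ : LitConj} :
    HoldsIn (fun c => c.toFormula ∈ w) φ ↔ φ.toFormula ∈ w := by
  rw [mem_litConj_toFormula]
  refine ⟨fun h l hl => ?_, fun h κ => ⟨h (.pos κ), fun hκ => mem_neg.1 (h (.neg κ) hκ)⟩⟩
  cases l with
  | pos κ => exact (h κ).1 hl
  | neg κ => exact mem_neg.2 ((h κ).2 hl)

theorem Satisfiable.exists_isCoreModel {φ : LitConj} (h : Satisfiable φ.toFormula) :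
    ∃ T, IsCoreModel T ∧ HoldsIn T φ := by
  obtain ⟨s, h, hφ⟩ := h
  exact ⟨_, isCoreModel_sat s h, fun κ => ⟨sat_litConj hφ (.pos κ), sat_litConj hφ (.neg κ)⟩⟩

/-! ### The septraction of two core types -/

section Sept

variable {X : Finset Var} {α : ℕ} {φ ψ χ : LitConj} {T : Core → Prop} {w a c : World}

theorem pos_or_neg_mem (hφ : φ ∈ coreTypes X α) {κ : Core} (hκ : κ ∈ coreFormulae X α) :
    .pos κ ∈ φ.lits ∨ .neg κ ∈ φ.lits := (hφ.2 κ hκ).1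

theorem SeptLit.mem_of_rel (h : Rel c w a) (ha : φ.toFormula ∈ a) (hc : ψ.toFormula ∈ c)
    {l : Literal} (hl : SeptLit φ ψ l) : l.toFormula ∈ w := by
  rw [← holdsIn_world] at ha hc
  cases hl with
  | eq x y hl =>
    exact hl.elim (fun hl => h.eq_left.2 (h.eq_right.1 ((ha _).1 hl)))
      fun hl => h.eq_left.2 ((hc _).1 hl)
  | ne x y hl =>
    exact mem_neg.2 fun hw => hl.elim (fun hl => (ha _).2 hl (h.eq_right.2 (h.eq_left.1 hw)))
      fun hl => (hc _).2 hl (h.eq_left.1 hw)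
  | alloc x h₁ h₂ => exact (h.alloc_iff.1 ((hc _).1 h₂)).resolve_right ((ha _).2 h₁)
  | notAlloc_right x h₁ => exact mem_neg.2 fun hw => (hc _).2 h₁ (h.alloc_left hw)
  | notAlloc_left x h₁ => exact mem_neg.2 (h.symm.not_alloc_right ((ha _).1 h₁))
  | notPts x y h₁ => exact mem_neg.2 fun hw => (hc _).2 h₁ (h.pts_left hw)
  | pts x y h₁ h₂ =>
    exact (h.pts_iff.1 ((hc _).1 h₂)).resolve_right fun hp => (ha _).2 h₁ (alloc_of_pts hp)
  | absurd_pts x y h₁ h₂ h₃ =>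
    exact absurd ((h.symm.pts_iff_left ((ha _).1 h₁)).1 ((hc _).1 h₃)) ((ha _).2 h₂)
  | absurd_notPts x y h₁ h₂ => exact absurd (h.symm.pts_left ((ha _).1 h₁)) ((hc _).2 h₂)
  | absurd_alloc x h₁ h₂ => exact absurd (h.symm.alloc_left ((ha _).1 h₁)) ((hc _).2 h₂)
  | size β₁ β₂ h₁ h₂ =>
    by_contra hn
    have := h.not_sizeGe hn ((ha _).2 h₁)
    -- When `β₁ > β₂ + 1` the subtraction truncates to `0`, and the literal is the trivial `size ≥
    -- 0`.
    by_cases hle : β₁ ≤ β₂ + 1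
    · rw [show β₂ + 1 - β₁ + β₁ - 1 = β₂ by omega] at this
      exact this ((hc _).1 h₂)
    · rw [show β₂ + 1 - β₁ = 0 by omega] at hn
      exact hn mem_top
  | notSize β₁ β₂ h₁ h₂ =>
    exact mem_neg.2 fun hw =>
      (hc _).2 h₂ (sizeGe_anti (h.sizeGe_add hw ((ha _).1 h₁)) (by omega))

/-- The sizes in a core type are unbounded within `α`, or determine an exact size. -/
theorem size_mem_or_exists_size (hφ : φ ∈ coreTypes X α) (hT : T (.size 0)) (h : HoldsIn T φ) :
    .pos (.size α) ∈ φ.lits ∨ ∃ β, .pos (.size β) ∈ φ.lits ∧ .neg (.size (β + 1)) ∈ φ.lits := by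
  by_contra hn
  rw [not_or, not_exists] at hn
  have : ∀ β ≤ α, .pos (.size β) ∈ φ.lits := by
    intro β
    induction β with
    | zero => exact fun h₀ => (pos_or_neg_mem hφ h₀).resolve_right fun h' => (h _).2 h' hT
    | succ β ih =>
      exact fun hβ => (pos_or_neg_mem hφ hβ).resolve_right fun h' =>
        hn.2 β ⟨ih (by omega), h'⟩
  exact hn.1 (this α le_rfl)

/-- As `φ` decides every core formula in `ψ`, each literal of `ψ` is settled in the composition by a
literal of `φ` in `a` together with one of `SeptLit` in `w`. The combinations that would violate `ψ`
contribute `x ≠ x`, which no world contains. -/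
theorem mem_of_forall_septLit (hφ : φ ∈ coreTypes X α) (hψ : ψ ∈ coreTypes X α)
    (h : Rel c w a) (ha : φ.toFormula ∈ a) (hw : ∀ l, SeptLit φ ψ l → l.toFormula ∈ w) :
    ψ.toFormula ∈ c := by
  rw [← holdsIn_world] at ha ⊢
  have hneg : ∀ {κ}, SeptLit φ ψ (.neg κ) → κ.toFormula ∉ w := fun hl => mem_neg.1 (hw _ hl)
  have habs : ∀ {x}, ¬ SeptLit φ ψ (.neg (.eq x x)) := fun hl => hneg hl (mem_eq_self _)
  have hsize := size_mem_or_exists_size hφ mem_top ha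
  have hX : ∀ {κ}, .pos κ ∈ ψ.lits ∨ .neg κ ∈ ψ.lits → .pos κ ∈ φ.lits ∨ .neg κ ∈ φ.lits :=
    fun hκ => pos_or_neg_mem hφ (hκ.elim (hψ.1 _) (hψ.1 _))
  rintro (⟨x, y⟩ | x | ⟨x, y⟩ | β) <;> refine ⟨fun hp => ?_, fun hn => ?_⟩
  · exact h.eq_left.1 (hw _ (.eq x y (.inr hp)))
  · exact fun hc => hneg (.ne x y (.inr hn)) (h.eq_left.2 hc)
  · exact (hX (.inl hp)).elim (fun hx => h.symm.alloc_left ((ha _).1 hx))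
      fun hx => h.alloc_left (hw _ (.alloc x hx hp))
  · refine fun hc => (h.alloc_iff.1 hc).elim (hneg (.notAlloc_right x hn)) ?_
    exact (hX (.inr hn)).elim (fun hx => absurd (.absurd_alloc x hx hn) habs) (ha _).2
  · have hx : .pos (.alloc x) ∈ φ.lits ∨ .neg (.alloc x) ∈ φ.lits :=
      pos_or_neg_mem hφ (hψ.1 _ hp).1
    rcases hx with hx | hx
    · exact (hX (.inl hp)).elim (fun hxy => h.symm.pts_left ((ha _).1 hxy))
        fun hxy => absurd (.absurd_pts x y hx hxy hp) habs
    · exact h.pts_left (hw _ (.pts x y hx hp))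
  · refine fun hc => (h.pts_iff.1 hc).elim (hneg (.notPts x y hn)) ?_
    exact (hX (.inr hn)).elim (fun hxy => absurd (.absurd_notPts x y hxy hn) habs) (ha _).2
  · rcases hsize with hs | ⟨k, hk, hk'⟩
    · exact sizeGe_anti (h.sizeGe_right ((ha _).1 hs)) (hψ.1 _ hp)
    · exact sizeGe_anti (h.sizeGe_add (hw _ (.size _ _ hk' hp)) ((ha _).1 hk)) (by omega)
  · rcases hsize with hs | ⟨k, hk, hk'⟩
    -- If `φ` contains `size ≥ α`, a negative size literal of `ψ` would put `¬ size ≥ 0` in `w`.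
    · have hβ : β ≤ α := hψ.1 _ hn
      have := hneg (.notSize _ _ hs hn)
      rw [Nat.sub_eq_zero_of_le hβ] at this
      exact absurd mem_top this
    · have := hneg (.notSize _ _ hk hn)
      have hkβ : k < β := by
        by_contra hle
        rw [Nat.sub_eq_zero_of_le (not_lt.1 hle)] at this
        exact this mem_top
      have := h.not_sizeGe this ((ha _).2 hk')
      rwa [show β - k + (k + 1) - 1 = β by omega] at this

theorem sept_mem_of_forall_septLit (hα : X.card ≤ α) (hφ : φ ∈ coreTypes X α)
    (hψ : ψ ∈ coreTypes X α) (hT : IsCoreModel T) (hφT : HoldsIn T φ)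
    (hw : ∀ l, SeptLit φ ψ l → l.toFormula ∈ w) : sept φ.toFormula ψ.toFormula ∈ w := by
  have hpos : ∀ κ ∈ coreFormulae X α, T κ → .pos κ ∈ φ.lits := fun κ hκ h =>
    (pos_or_neg_mem hφ hκ).resolve_right fun hn => (hφT κ).2 hn h
  have hneg : ∀ κ ∈ coreFormulae X α, ¬ T κ → .neg κ ∈ φ.lits := fun κ hκ h =>
    (pos_or_neg_mem hφ hκ).resolve_left fun hn => h ((hφT κ).1 hn)
  obtain ⟨a, c, h, ha⟩ := exists_rel_coreFormulae (w := w) hα hT (fun x hx y hy => ⟨fun he => by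
      by_contra hn
      exact mem_neg.1 (hw _ (.ne x y (.inl (hneg (.eq x y) ⟨hx, hy⟩ hn)))) he,
      fun he => hw _ (.eq x y (.inl (hpos (.eq x y) ⟨hx, hy⟩ he)))⟩)
    fun x hx hxT => mem_neg.1 (hw _ (.notAlloc_left x (hpos (.alloc x) hx hxT)))
  have hφa : φ.toFormula ∈ a := holdsIn_world.1 fun κ =>
    ⟨fun hκ => (ha κ (hφ.1 _ hκ)).2 ((hφT κ).1 hκ),
      fun hκ hm => (hφT κ).2 hκ ((ha κ (hφ.1 _ hκ)).1 hm)⟩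
  exact h.mem_sept hφa (mem_of_forall_septLit hφ hψ h hφa hw)

theorem IsSeptFormula.provable_iff (hα : X.card ≤ α) (hφ : φ ∈ coreTypes X α)
    (hψ : ψ ∈ coreTypes X α) (hT : IsCoreModel T) (hφT : HoldsIn T φ)
    (hχ : IsSeptFormula φ ψ χ) :
    Provable ((φ.toFormula.sept ψ.toFormula).iff χ.toFormula) := by
  refine provable_of_forall_world fun w => mem_iff.2 ?_
  rw [mem_litConj_toFormula]
  constructor
  · intro h l hl
    obtain ⟨a, c, hr, ha, hc⟩ := exists_rel_of_sept h
    exact SeptLit.mem_of_rel hr ha hc ((hχ l).1 hl)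
  · exact fun h => sept_mem_of_forall_septLit hα hφ hψ hT hφT fun l hl => h l ((hχ l).2 hl)

/-- Only `size ≥ (β₂ + 1) - β₁` could exceed the bound, namely for `β₁ = 0`. That would need `¬ size
≥ 0` in `φ`, which no core model satisfies. -/
theorem SeptLit.core_mem (hφ : φ ∈ coreTypes X α) (hψ : ψ ∈ coreTypes X α)
    (hT : IsCoreModel T) (hφT : HoldsIn T φ) {l : Literal} (hl : SeptLit φ ψ l) :
    l.core ∈ coreFormulae X α := by
  cases hl with
  | eq x y hl => exact hl.elim (hφ.1 _) (hψ.1 _)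
  | ne x y hl => exact hl.elim (hφ.1 _) (hψ.1 _)
  | alloc x _ h₂ => exact hψ.1 _ h₂
  | notAlloc_right x h₁ => exact hψ.1 _ h₁
  | notAlloc_left x h₁ => exact hφ.1 (.pos (.alloc x)) h₁
  | notPts x y h₁ => exact hψ.1 _ h₁
  | pts x y _ h₂ => exact hψ.1 _ h₂
  | absurd_pts x y h₁ _ _ => exact ⟨hφ.1 _ h₁, hφ.1 _ h₁⟩
  | absurd_notPts x y h₁ _ => exact ⟨(hφ.1 _ h₁).1, (hφ.1 _ h₁).1⟩
  | absurd_alloc x h₁ _ => exact ⟨hφ.1 _ h₁, hφ.1 _ h₁⟩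
  | size β₁ β₂ h₁ h₂ =>
    have hβ₂ : β₂ ≤ α := hψ.1 _ h₂
    have hβ₁ : β₁ ≠ 0 := by
      rintro rfl
      exact (hφT _).2 h₁ hT.size_zero
    exact show β₂ + 1 - β₁ ≤ α by omega
  | notSize β₁ β₂ _ h₂ => exact (Nat.sub_le β₂ β₁).trans (hψ.1 _ h₂)

theorem finite_coreFormulae (X : Finset Var) (α : ℕ) : (coreFormulae X α).Finite := by
  refine ((((X ×ˢ X).finite_toSet.image fun p => Core.eq p.1 p.2).union
    (X.finite_toSet.image Core.alloc)).union
    (((X ×ˢ X).finite_toSet.image fun p => Core.pts p.1 p.2).union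
    ((Set.finite_Iic α).image Core.size))).subset ?_
  rintro (⟨x, y⟩ | x | ⟨x, y⟩ | β) h <;> simpa [coreFormulae] using h

theorem exists_lits_eq {s : Set Literal} (hs : s.Finite) : ∃ χ : LitConj, χ.lits = s := by
  induction s, hs using Set.Finite.induction_on with
  | empty => exact ⟨.top, rfl⟩
  | insert _ _ ih =>
    obtain ⟨χ, rfl⟩ := ih
    exact ⟨.and (.lit _) χ, rfl⟩

theorem exists_isSeptFormula (hφ : φ ∈ coreTypes X α) (hψ : ψ ∈ coreTypes X α)
    (hT : IsCoreModel T) (hφT : HoldsIn T φ) : ∃ χ, IsSeptFormula φ ψ χ := by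
  have hfin : {l | SeptLit φ ψ l}.Finite := by
    refine (((finite_coreFormulae X α).image Literal.pos).union
      ((finite_coreFormulae X α).image Literal.neg)).subset fun l hl => ?_
    have := SeptLit.core_mem hφ hψ hT hφT hl
    cases l with
    | pos κ => exact .inl ⟨κ, this, rfl⟩
    | neg κ => exact .inr ⟨κ, this, rfl⟩
  obtain ⟨χ, hχ⟩ := exists_lits_eq hfin
  exact ⟨χ, fun l => by rw [hχ]; rfl⟩

theorem IsSeptFormula.mem_coreConj (hφ : φ ∈ coreTypes X α) (hψ : ψ ∈ coreTypes X α)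
    (hT : IsCoreModel T) (hφT : HoldsIn T φ) (hχ : IsSeptFormula φ ψ χ) : χ ∈ coreConj X α :=
  fun l hl => ((hχ l).1 hl).core_mem hφ hψ hT hφT

end Sept

end QFSL

theorem mainTheorem4 (X : Finset QFSL.Var) (α : ℕ) (hα : X.card ≤ α)
    (φ ψ : QFSL.LitConj) (hφ : φ ∈ QFSL.coreTypes X α) (hψ : ψ ∈ QFSL.coreTypes X α) :
    (∃ χ ∈ QFSL.coreConj X α,
      QFSL.Provable ((φ.toFormula.sept ψ.toFormula).iff χ.toFormula)) ∧
    (QFSL.Satisfiable φ.toFormula → QFSL.Satisfiable ψ.toFormula →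
      (∃ χ, QFSL.IsSeptFormula φ ψ χ) ∧
      ∀ χ, QFSL.IsSeptFormula φ ψ χ → χ ∈ QFSL.coreConj X α ∧
        QFSL.Provable ((φ.toFormula.sept ψ.toFormula).iff χ.toFormula)) := by
  refine ⟨?_, fun hsat _ => ?_⟩
  -- A world containing `φ` serves as the core model, so the explicit formula works even without a
  -- memory state satisfying `φ`.
  · by_cases hcons : ∃ u : QFSL.World, φ.toFormula ∈ u
    · obtain ⟨u, hu⟩ := hcons
      have hu' := QFSL.holdsIn_world.2 hu
      obtain ⟨χ, hχ⟩ := QFSL.exists_isSeptFormula hφ hψ u.isCoreModel hu'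
      exact ⟨χ, hχ.mem_coreConj hφ hψ u.isCoreModel hu',
        hχ.provable_iff hα hφ hψ u.isCoreModel hu'⟩
    -- An inconsistent `φ` makes the septraction false in every world; `¬ size ≥ 0` is a
    -- contradiction available for every `X` and `α`.
    · refine ⟨.lit (.neg (.size 0)), ?_, QFSL.provable_of_forall_world fun w =>
        QFSL.World.mem_iff.2 (iff_of_false (fun h => ?_) ?_)⟩
      · rintro l rfl
        exact Nat.zero_le α
      · obtain ⟨a, c, -, ha, -⟩ := QFSL.World.exists_rel_of_sept h
        exact hcons ⟨a, ha⟩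
      · exact fun h => QFSL.World.mem_neg.1 h QFSL.World.mem_top
  · obtain ⟨T, hT, hφT⟩ := hsat.exists_isCoreModel
    exact ⟨QFSL.exists_isSeptFormula hφ hψ hT hφT, fun χ hχ =>
      ⟨hχ.mem_coreConj hφ hψ hT hφT, hχ.provable_iff hα hφ hψ hT hφT⟩⟩
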